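/- Let $\kappa\in(0,1)$ and $\lambda=\sqrt{1-\kappa^2}$. Put $$f(T)=\int_0^T {}_2F_1\left(\tfrac14,\tfrac34;\tfrac12;\kappa^2\sin^2 t\right)dt$$ for complex $T$ near $0$. On a sufficiently small open disc $D$ about $0$ there are analytic functions $\varphi$ and $\psi$ such that $\varphi$ is the local inverse of $f$ at $0$ (with $\varphi(0)=0$ and $f(\varphi(z))=z$ on $D$), $\psi(0)=0$ and $\sin\psi=\kappa\sin\varphi$ on $D$; put $\mathrm{dn}_2=\cos\psi$ on any such disc $D$. There is a lattice in $\mathbb C$ whose Weierstrass function $\wp$ has invariants $$g_2=\tfrac43-\kappa^2=\lambda^2+\tfrac13,\qquad g_3=\tfrac8{27}-\tfrac13\kappa^2=\tfrac13\lambda^2-\tfrac1{27}.$$ For the Weierstrass function $\wp$ of any lattice $\Lambda$ with these invariants, $$(1-\mathrm{dn}_2)\left(\tfrac13+\wp\right)=\tfrac12\kappa^2\quad\text{on } D\setminus\Lambda .$$ Hence $\mathrm{dn}_2$ extends globally to an elliptic function: there is a meromorphic function $g$ on $\mathbb C$, with every element of $\Lambda$ as a period, that coincides with $\mathrm{dn}_2$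 on every such disc $D$ and satisfies $(1-g(z))\left(\tfrac13+\wp(z)\right)=\tfrac12\kappa^2$ for all $z\in\mathbb C\setminus\Lambda$ with $\wp(z)\ne-\tfrac13$. -/

import Mathlib

noncomputable section

/-- The complementary modulus `λ = √(1 - κ²)`. -/
def complementaryModulus (κ : ℝ) : ℝ := √(1 - κ ^ 2)

/-- The function `f(T) = ∫₀ᵀ F(1/4, 3/4; 1/2; κ² sin² t) dt` of a complex variable `T`; the integral
is taken along the straight segment `t = s T`, `0 ≤ s ≤ 1`. -/
def sigFourIntegral (κ : ℝ) (T : ℂ) : ℂ :=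
  ∫ s in (0 : ℝ)..1,
    T * ordinaryHypergeometric (1 / 4 : ℂ) (3 / 4 : ℂ) (1 / 2 : ℂ)
      ((κ : ℂ) ^ 2 * Complex.sin ((s : ℂ) * T) ^ 2)

/-- The data in the local construction of `dn₂` on the open disc `D` of radius `r` about `0`:
`φ` is analytic in `D` and is the local inverse of `f` at `0`, and `ψ` is analytic in `D` with
`ψ 0 = 0` and `sin ψ = κ sin φ`. -/
structure IsDnTwoData (κ r : ℝ) (φ ψ : ℂ → ℂ) : Prop where
  radius_pos : 0 < r
  analytic_phi : AnalyticOnNhd ℂ φ (Metric.ball 0 r)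
  phi_zero : φ 0 = 0
  right_inv : ∀ z ∈ Metric.ball (0 : ℂ) r, sigFourIntegral κ (φ z) = z
  left_inv : ∀ᶠ T in nhds (0 : ℂ), φ (sigFourIntegral κ T) = T
  analytic_psi : AnalyticOnNhd ℂ ψ (Metric.ball 0 r)
  psi_zero : ψ 0 = 0
  sin_psi : ∀ z ∈ Metric.ball (0 : ℂ) r, Complex.sin (ψ z) = κ * Complex.sin (φ z)

/-- The function `dn₂ = cos ψ`, as initially defined in the disc. -/
def dnTwo (ψ : ℂ → ℂ) (z : ℂ) : ℂ := Complex.cos (ψ z)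

/-- The Weierstrass function of the period lattice `L` has the invariants
`g₂ = λ² + 1/3` and `g₃ = λ²/3 - 1/27`. -/
def HasDnTwoInvariants (κ : ℝ) (L : PeriodPair) : Prop :=
  L.g₂ = (complementaryModulus κ : ℂ) ^ 2 + 1 / 3 ∧
    L.g₃ = (complementaryModulus κ : ℂ) ^ 2 / 3 - 1 / 27

/-- `g` is an elliptic function with respect to the lattice of `L`: it is meromorphic on `ℂ`
(with no removable singularities; at a pole it takes the conventional value `0`) and every element
of the lattice is a period. -/
def IsEllipticFor (L : PeriodPair) (g : ℂ → ℂ) : Prop :=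
  MeromorphicNFOn g Set.univ ∧ ∀ w ∈ L.lattice, Function.Periodic g w

end

/-! With `F(u) = ₂F₁(1/4, 3/4; 1/2; u)`, the binomial series of `(1 ± y) ^ (-1/2)` give
`F(sin² x) cos x = cos (x / 2)`. Differentiating `f (φ z) = z` and `sin ψ = κ sin φ` therefore shows
that `sin (ψ / 2)` has derivative `(κ / 2) cos φ`, so that `v = dn₂ = 1 - 2 sin² (ψ / 2)` solves
`(dv/dz)² = 2 (1 - v) (v² - λ²)` with `v 0 = 1`. By the differential equation of `℘`, the function
`1 - (κ² / 2) / (1/3 + ℘)` is another non-constant solution taking the value `1` at the origin, so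
the two agree near the origin by uniqueness, and on the whole disc by the identity theorem.

A lattice with invariants `(a, b)`, where `27 b² < a³`, is found among the multiples of `ℤτ + ℤ`
with `τ` on the imaginary axis above `i`: there `E₆² / E₄³` varies continuously from `0` at `i` to
`1` at the cusp, so it takes the value `27 b² / a³`. -/

open Filter Topology

section Hypergeometric

theorem ordinaryHypergeometricCoefficient_succ {𝕂 : Type*} [Field 𝕂] (a b c : 𝕂) (n : ℕ) :
    ordinaryHypergeometricCoefficient a b c (n + 1) =
      ordinaryHypergeometricCoefficient a b c n *
        ((a + n) * (b + n) / ((c + n) * (n + 1))) := by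
  simp only [ordinaryHypergeometricCoefficient, ascPochhammer_succ_eval, Nat.factorial_succ,
    Nat.cast_mul, Nat.cast_add, Nat.cast_one, mul_inv, div_eq_mul_inv]
  ring

theorem succ_mul_ringChoose_succ {R : Type*} [CommRing R] [BinomialRing R] (r : R) (n : ℕ) :
    (n + 1) * Ring.choose r (n + 1) = (r - n) * Ring.choose r n := by
  have h := Ring.choose_smul_choose r n.le_succ
  rw [Nat.succ_eq_add_one, Nat.add_sub_cancel_left, Ring.choose_one_right, nsmul_eq_mul,
    Nat.choose_succ_self_right] at h
  push_cast at h
  rw [h, mul_comm]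

theorem ringChoose_neg_two_mul_two_mul {𝕂 : Type*} [Field 𝕂] [CharZero 𝕂] (a : 𝕂) (n : ℕ) :
    Ring.choose (-(2 * a)) (2 * n) =
      ordinaryHypergeometricCoefficient a (a + 1 / 2) (1 / 2) n := by
  induction n with
  | zero => simp [ordinaryHypergeometricCoefficient]
  | succ n ih =>
    have choose_succ := succ_mul_ringChoose_succ (-(2 * a)) (2 * n)
    have choose_succ_succ := succ_mul_ringChoose_succ (-(2 * a)) (2 * n + 1)
    have odd_ne : (1 + 2 * n : 𝕂) ≠ 0 := by norm_cast; omega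
    have succ_ne : (n + 1 : 𝕂) ≠ 0 := by exact_mod_cast n.succ_ne_zero
    rw [ih] at choose_succ
    push_cast at choose_succ choose_succ_succ
    refine mul_left_cancel₀ (mul_ne_zero odd_ne succ_ne) ?_
    rw [ordinaryHypergeometricCoefficient_succ, show 2 * (n + 1) = 2 * n + 1 + 1 by ring]
    generalize ordinaryHypergeometricCoefficient a (a + 1 / 2) (1 / 2) n = A at *
    have ratio : (1 + 2 * n) * (n + 1) * (A * ((a + n) * (a + 1 / 2 + n) /
        ((1 / 2 + n) * (n + 1)))) = (2 * a + 2 * n) * (a + 1 / 2 + n) * A := by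
      field
    rw [ratio]
    linear_combination
      (2 * n + 1 : 𝕂) / 2 * choose_succ_succ - (2 * a + 2 * n + 1) / 2 * choose_succ

theorem hasSum_ringChoose_mul_pow (a : ℂ) {y : ℂ} (hy : ‖y‖ < 1) :
    HasSum (fun n ↦ Ring.choose a n * y ^ n) ((1 + y) ^ a) := by
  have := (Complex.one_add_cpow_hasFPowerSeriesOnBall_zero (a := a)).hasSum (y := y)
    (by simpa [enorm_eq_nnnorm, ← NNReal.coe_lt_coe] using hy)
  simpa [binomialSeries, mul_comm, FormalMultilinearSeries.coeff_ofScalars] using this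

/-- The binomial series of `(1 + y) ^ (-2a)` and `(1 - y) ^ (-2a)` have the same even part and
opposite odd parts. -/
theorem ordinaryHypergeometric_sq_of_norm_lt_one (a : ℂ) {y : ℂ} (hy : ‖y‖ < 1) :
    ordinaryHypergeometric a (a + 1 / 2) (1 / 2) (y ^ 2) =
      ((1 + y) ^ (-(2 * a)) + (1 - y) ^ (-(2 * a))) / 2 := by
  have hsum := ((hasSum_ringChoose_mul_pow (-(2 * a)) hy).add
    (hasSum_ringChoose_mul_pow (-(2 * a)) (y := -y) (by rwa [norm_neg]))).div_const 2
  have two_mul_injective : Function.Injective fun n : ℕ ↦ 2 * n :=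
    mul_right_injective₀ two_ne_zero
  have odd_term_eq_zero : ∀ n ∉ Set.range fun n : ℕ ↦ 2 * n,
      (Ring.choose (-(2 * a)) n * y ^ n + Ring.choose (-(2 * a)) n * (-y) ^ n) / 2 = 0 := by
    intro n hn
    have hodd : Odd n := by
      rw [← Nat.not_even_iff_odd, even_iff_exists_two_mul]
      exact fun ⟨k, hk⟩ ↦ hn ⟨k, hk.symm⟩
    rw [hodd.neg_pow]
    ring
  rw [← two_mul_injective.hasSum_iff odd_term_eq_zero, ← sub_eq_add_neg] at hsum
  rw [ordinaryHypergeometric_eq_tsum, ← hsum.tsum_eq]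
  refine tsum_congr fun n ↦ ?_
  rw [Function.comp_apply, ringChoose_neg_two_mul_two_mul, (even_two_mul n).neg_pow, smul_eq_mul,
    ordinaryHypergeometricCoefficient, pow_mul]
  ring

theorem eventually_ordinaryHypergeometric_quarter_sin_sq :
    ∀ᶠ z : ℂ in 𝓝 0, ordinaryHypergeometric (1 / 4 : ℂ) (3 / 4) (1 / 2) (Complex.sin z ^ 2) *
      Complex.cos z = Complex.cos (z / 2) := by
  have norm_sin_lt : ∀ᶠ z : ℂ in 𝓝 0, ‖Complex.sin z‖ < 1 :=
    (Complex.continuous_sin.norm.tendsto 0).eventually_lt_const (by simp)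
  have re_add_pos : ∀ᶠ z : ℂ in 𝓝 0, 0 < (Complex.cos (z / 2) + Complex.sin (z / 2)).re :=
    ContinuousAt.eventually_lt continuousAt_const (by fun_prop) (by simp)
  have re_sub_pos : ∀ᶠ z : ℂ in 𝓝 0, 0 < (Complex.cos (z / 2) - Complex.sin (z / 2)).re :=
    ContinuousAt.eventually_lt continuousAt_const (by fun_prop) (by simp)
  filter_upwards [norm_sin_lt, re_add_pos, re_sub_pos] with z hz hadd hsub
  have hF := ordinaryHypergeometric_sq_of_norm_lt_one (1 / 4) hz
  have hsin : Complex.sin z = 2 * Complex.sin (z / 2) * Complex.cos (z / 2) := by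
    rw [← Complex.sin_two_mul, mul_div_cancel₀ z two_ne_zero]
  have hcos : Complex.cos z = Complex.cos (z / 2) ^ 2 - Complex.sin (z / 2) ^ 2 := by
    rw [← Complex.cos_two_mul', mul_div_cancel₀ z two_ne_zero]
  have hpyth := Complex.sin_sq_add_cos_sq (z / 2)
  have add_sq : 1 + Complex.sin z = (Complex.cos (z / 2) + Complex.sin (z / 2)) ^ 2 := by
    linear_combination hsin - hpyth
  have sub_sq : 1 - Complex.sin z = (Complex.cos (z / 2) - Complex.sin (z / 2)) ^ 2 := by
    linear_combination -hsin - hpyth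
  have add_ne : Complex.cos (z / 2) + Complex.sin (z / 2) ≠ 0 := fun h ↦ by simp [h] at hadd
  have sub_ne : Complex.cos (z / 2) - Complex.sin (z / 2) ≠ 0 := fun h ↦ by simp [h] at hsub
  have sq_cpow {w : ℂ} (hw : 0 < w.re) : (w ^ 2) ^ (-(2 * (1 / 4)) : ℂ) = w⁻¹ := by
    rw [show (-(2 * (1 / 4)) : ℂ) = -2⁻¹ by norm_num, Complex.cpow_neg,
      Complex.sq_cpow_two_inv hw]
  rw [add_sq, sub_sq, sq_cpow hadd, sq_cpow hsub, show (1 / 4 + 1 / 2 : ℂ) = 3 / 4 by norm_num]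
    at hF
  rw [hF, hcos]
  field_simp
  ring

theorem ordinaryHypergeometricSeries_radius_pos {𝕂 : Type*} (𝔸 : Type*) [RCLike 𝕂]
    [NormedDivisionRing 𝔸] [NormedAlgebra 𝕂 𝔸] (a b c : 𝕂) :
    0 < (ordinaryHypergeometricSeries 𝔸 a b c).radius := by
  by_cases! h : ∃ k : ℕ, a = -k ∨ b = -k ∨ c = -k
  · obtain ⟨k, rfl | rfl | rfl⟩ := h
    · simp [ordinaryHypergeometric_radius_top_of_neg_nat₁]
    · simp [ordinaryHypergeometric_radius_top_of_neg_nat₂]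
    · simp [ordinaryHypergeometric_radius_top_of_neg_nat₃]
  · simp only [ne_eq, eq_neg_iff_add_eq_zero] at h
    rw [ordinaryHypergeometricSeries_radius_eq_one 𝔸 a b c fun k ↦ by
      simpa only [ne_eq, eq_neg_iff_add_eq_zero, add_comm] using h k]
    exact one_pos

theorem analyticAt_ordinaryHypergeometric_zero {𝕂 : Type*} {𝔸 : Type*} [RCLike 𝕂]
    [NormedDivisionRing 𝔸] [NormedAlgebra 𝕂 𝔸] [CompleteSpace 𝔸] (a b c : 𝕂) :
    AnalyticAt 𝕂 (ordinaryHypergeometric a b c : 𝔸 → 𝔸) 0 :=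
  (FormalMultilinearSeries.hasFPowerSeriesOnBall _
    (ordinaryHypergeometricSeries_radius_pos 𝔸 a b c)).analyticAt

end Hypergeometric

section LocalInverse

theorem hasDerivWithinAt_integral_segment {𝕜 E : Type*} [RCLike 𝕜] [NormedAddCommGroup E]
    [NormedSpace ℝ E] [NormedSpace 𝕜 E] [CompleteSpace E] {f : 𝕜 → E} {s : Set 𝕜}
    (hs : Convex ℝ s) (hf : DifferentiableOn 𝕜 f s) {a b : 𝕜} (ha : a ∈ s) (hb : b ∈ s) :
    HasDerivWithinAt (fun z ↦ ∫ t in (0 : ℝ)..1, (z - a) • f (AffineMap.lineMap a z t))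
      (f b) s b := by
  let ω (z : 𝕜) : 𝕜 →L[𝕜] E := ContinuousLinearMap.smulRightL 𝕜 𝕜 E 1 (f z)
  have hω := hs.hasFDerivWithinAt_curveIntegral_segment_of_hasFDerivWithinAt_symmetric (ω := ω)
    (fun z hz ↦ (ContinuousLinearMap.smulRightL 𝕜 𝕜 E 1).hasFDerivAt
      |>.comp_hasDerivWithinAt z (hf z hz).hasDerivWithinAt |>.restrictScalars ℝ)
    (fun z _ u _ v _ ↦ by simpa using smul_comm ..) ha hb
  simpa [ω, curveIntegral_segment] using hω.hasDerivWithinAt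

theorem exists_analyticAt_localInverse {𝕜 : Type*} [NontriviallyNormedField 𝕜] [CompleteSpace 𝕜]
    [CharZero 𝕜] {f : 𝕜 → 𝕜} {x : 𝕜} (hf : AnalyticAt 𝕜 f x) (hf' : deriv f x ≠ 0) :
    ∃ g : 𝕜 → 𝕜, AnalyticAt 𝕜 g (f x) ∧ g (f x) = x ∧
      (∀ᶠ y in 𝓝 (f x), f (g y) = y) ∧ ∀ᶠ y in 𝓝 x, g (f y) = y :=
  have left_inv := hf.hasStrictDerivAt.eventually_left_inverse hf'
  ⟨hf.hasStrictDerivAt.localInverse f _ x hf', hf.analyticAt_localInverse hf',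
    left_inv.self_of_nhds, hf.hasStrictDerivAt.eventually_right_inverse hf', left_inv⟩

/-- The integrand `₂F₁(1/4, 3/4; 1/2; κ² sin² t)` of `sigFourIntegral`. -/
noncomputable def sigFourIntegrand (κ : ℝ) (t : ℂ) : ℂ :=
  ordinaryHypergeometric (1 / 4 : ℂ) (3 / 4 : ℂ) (1 / 2 : ℂ) ((κ : ℂ) ^ 2 * Complex.sin t ^ 2)

theorem sigFourIntegrand_zero (κ : ℝ) : sigFourIntegrand κ 0 = 1 := by
  simp [sigFourIntegrand]

theorem analyticAt_sigFourIntegrand_zero (κ : ℝ) : AnalyticAt ℂ (sigFourIntegrand κ) 0 := by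
  have := analyticAt_ordinaryHypergeometric_zero (𝔸 := ℂ) (1 / 4 : ℂ) (3 / 4) (1 / 2)
  exact this.comp_of_eq (by fun_prop) (by simp)

theorem sigFourIntegral_zero (κ : ℝ) : sigFourIntegral κ 0 = 0 := by
  simp [sigFourIntegral]

theorem eventually_hasDerivAt_sigFourIntegral (κ : ℝ) :
    ∀ᶠ z in 𝓝 0, HasDerivAt (sigFourIntegral κ) (sigFourIntegrand κ z) z := by
  obtain ⟨r, hr, hball⟩ := Metric.eventually_nhds_iff_ball.1
    (analyticAt_sigFourIntegrand_zero κ).eventually_analyticAt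
  filter_upwards [Metric.ball_mem_nhds 0 hr] with z hz
  have := hasDerivWithinAt_integral_segment (convex_ball 0 r)
    (fun w hw ↦ (hball w hw).differentiableAt.differentiableWithinAt) (Metric.mem_ball_self hr) hz
  have := this.hasDerivAt (Metric.isOpen_ball.mem_nhds hz)
  simp only [AffineMap.lineMap_apply_module', sub_zero, add_zero, smul_eq_mul, Complex.real_smul]
    at this
  exact this

theorem analyticAt_sigFourIntegral_zero (κ : ℝ) : AnalyticAt ℂ (sigFourIntegral κ) 0 :=
  Complex.analyticAt_iff_eventually_differentiableAt.2
    ((eventually_hasDerivAt_sigFourIntegral κ).mono fun _ h ↦ h.differentiableAt)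

theorem deriv_sigFourIntegral_zero (κ : ℝ) : deriv (sigFourIntegral κ) 0 = 1 := by
  rw [(eventually_hasDerivAt_sigFourIntegral κ).self_of_nhds.deriv, sigFourIntegrand_zero]

theorem exists_isDnTwoData (κ : ℝ) : ∃ (r : ℝ) (φ ψ : ℂ → ℂ), IsDnTwoData κ r φ ψ := by
  obtain ⟨φ, φ_analytic, φ_zero, right_inv, left_inv⟩ := exists_analyticAt_localInverse
    (analyticAt_sigFourIntegral_zero κ) (by simp [deriv_sigFourIntegral_zero])
  obtain ⟨arcsin, arcsin_analytic, arcsin_zero, sin_arcsin, -⟩ := exists_analyticAt_localInverse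
    (Complex.analyticAt_sin (x := 0)) (by simp)
  rw [sigFourIntegral_zero] at φ_analytic φ_zero right_inv
  rw [Complex.sin_zero] at arcsin_analytic arcsin_zero sin_arcsin
  set s : ℂ → ℂ := fun z ↦ κ * Complex.sin (φ z) with s_def
  have s_zero : s 0 = 0 := by simp [s_def, φ_zero]
  have s_analytic : AnalyticAt ℂ s 0 := by fun_prop
  have ψ_analytic : AnalyticAt ℂ (arcsin ∘ s) 0 := arcsin_analytic.comp_of_eq s_analytic s_zero
  have sin_ψ : ∀ᶠ z in 𝓝 0, Complex.sin (arcsin (s z)) = s z :=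
    s_analytic.continuousAt.eventually (by rwa [s_zero])
  obtain ⟨r, r_pos, hball⟩ := Metric.eventually_nhds_iff_ball.1
    (φ_analytic.eventually_analyticAt.and
      (right_inv.and (ψ_analytic.eventually_analyticAt.and sin_ψ)))
  exact ⟨r, φ, arcsin ∘ s,
    { radius_pos := r_pos
      analytic_phi := fun z hz ↦ (hball z hz).1
      phi_zero := φ_zero
      right_inv := fun z hz ↦ (hball z hz).2.1
      left_inv := left_inv
      analytic_psi := fun z hz ↦ (hball z hz).2.2.1
      psi_zero := by rw [Function.comp_apply, s_zero, arcsin_zero]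
      sin_psi := fun z hz ↦ (hball z hz).2.2.2 }⟩

end LocalInverse

section AnalyticODE

open Asymptotics

variable {𝕜 E F : Type*} [NontriviallyNormedField 𝕜] [NormedAddCommGroup E] [NormedSpace 𝕜 E]
  [NormedAddCommGroup F] [NormedSpace 𝕜 F] {x : 𝕜}

theorem isBigO_sub_pow_of_le_analyticOrderAt {f : 𝕜 → E} (hf : AnalyticAt 𝕜 f x) {n : ℕ}
    (hn : n ≤ analyticOrderAt f x) : f =O[𝓝 x] fun z ↦ (z - x) ^ n := by
  obtain ⟨g, g_analytic, hfg⟩ := (natCast_le_analyticOrderAt hf).1 hn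
  calc f =ᶠ[𝓝 x] fun z ↦ (z - x) ^ n • g z := hfg
    _ =O[𝓝 x] fun z ↦ (z - x) ^ n • (1 : 𝕜) :=
      (isBigO_refl _ _).smul (g_analytic.continuousAt.isBigO_one 𝕜)
    _ = fun z ↦ (z - x) ^ n := by simp

theorem sub_pow_isBigO_of_analyticOrderAt_eq {f : 𝕜 → E} (hf : AnalyticAt 𝕜 f x) {n : ℕ}
    (hn : analyticOrderAt f x = n) : (fun z ↦ (z - x) ^ n) =O[𝓝 x] f := by
  obtain ⟨g, g_analytic, g_ne, hfg⟩ := hf.analyticOrderAt_eq_natCast.1 hn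
  have one_isBigO : (fun _ ↦ 1 : 𝕜 → 𝕜) =O[𝓝 x] g :=
    (isBigO_const_left_iff_pos_le_norm one_ne_zero).2
      ⟨_, half_pos (norm_pos_iff.2 g_ne), (g_analytic.continuousAt.norm.eventually_const_lt
        (half_lt_self (norm_pos_iff.2 g_ne))).mono fun _ h ↦ h.le⟩
  calc (fun z ↦ (z - x) ^ n) = fun z ↦ (z - x) ^ n • (1 : 𝕜) := by simp
    _ =O[𝓝 x] fun z ↦ (z - x) ^ n • g z := (isBigO_refl _ _).smul one_isBigO
    _ =ᶠ[𝓝 x] f := EventuallyEq.symm hfg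

theorem analyticOrderAt_le_of_isBigO {f : 𝕜 → E} {g : 𝕜 → F} (hf : AnalyticAt 𝕜 f x)
    (hg : AnalyticAt 𝕜 g x) (hfg : f =O[𝓝 x] g) : analyticOrderAt g x ≤ analyticOrderAt f x := by
  refine ENat.forall_natCast_le_iff_le.1 fun n hn ↦ not_lt.1 fun f_lt ↦ ?_
  obtain ⟨m, hm⟩ := ENat.ne_top_iff_exists.1 (f_lt.trans_le le_top).ne
  have hmn : m < n := by rw [← hm] at f_lt; exact_mod_cast f_lt
  have pow_isBigO : (fun z ↦ (z - x) ^ m) =O[𝓝 x] fun z ↦ (z - x) ^ n :=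
    ((sub_pow_isBigO_of_analyticOrderAt_eq hf hm.symm).trans hfg).trans
      (isBigO_sub_pow_of_le_analyticOrderAt hg hn)
  have pow_isLittleO : (fun z ↦ (z - x) ^ n) =o[𝓝 x] fun z ↦ (z - x) ^ m :=
    isLittleO_norm_norm.1 (by simpa only [norm_pow] using isLittleO_pow_sub_pow_sub x hmn)
  have pow_ne_zero : ∀ᶠ z in 𝓝[≠] x, (z - x) ^ m ≠ 0 :=
    eventually_mem_nhdsWithin.mono fun z hz ↦ pow_ne_zero m (sub_ne_zero.2 hz)
  exact isLittleO_irrefl (pow_ne_zero.frequently.filter_mono nhdsWithin_le_nhds)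
    (pow_isBigO.trans_isLittleO pow_isLittleO)

variable [CharZero 𝕜] [CompleteSpace E]

theorem eventuallyEq_zero_of_deriv_deriv_isBigO {e : 𝕜 → E} (he : AnalyticAt 𝕜 e x)
    (he₀ : e x = 0) (he₁ : deriv e x = 0) (h : deriv (deriv e) =O[𝓝 x] e) : e =ᶠ[𝓝 x] 0 := by
  have order_le := analyticOrderAt_le_of_isBigO he.deriv.deriv he h
  have order₁ := he.analyticOrderAt_deriv_add_one
  have order₂ := he.deriv.analyticOrderAt_deriv_add_one
  simp only [he₀, he₁, sub_zero] at order₁ order₂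
  rw [← order₁, ← order₂] at order_le
  suffices order_top : analyticOrderAt (deriv (deriv e)) x = ⊤ by
    rw [order_top, top_add] at order₂
    rw [← order₂, top_add] at order₁
    exact analyticOrderAt_eq_top.1 order₁.symm
  by_contra order_ne_top
  obtain ⟨n, hn⟩ := ENat.ne_top_iff_exists.1 order_ne_top
  rw [← hn] at order_le
  norm_cast at order_le
  omega

theorem eventuallyEq_of_deriv_deriv_eq_comp {q : E → E} {q' : E →L[𝕜] E} {v w : 𝕜 → E}
    (hv : AnalyticAt 𝕜 v x) (hw : AnalyticAt 𝕜 w x) (hq : HasStrictFDerivAt q q' (v x))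
    (hv_ode : deriv (deriv v) =ᶠ[𝓝 x] q ∘ v) (hw_ode : deriv (deriv w) =ᶠ[𝓝 x] q ∘ w)
    (h₀ : v x = w x) (h₁ : deriv v x = deriv w x) : v =ᶠ[𝓝 x] w := by
  have deriv_sub_eq : deriv (v - w) =ᶠ[𝓝 x] deriv v - deriv w := by
    filter_upwards [hv.eventually_analyticAt, hw.eventually_analyticAt] with z hv hw
      using deriv_sub hv.differentiableAt hw.differentiableAt
  have deriv_deriv_sub_eq : deriv (deriv (v - w)) =ᶠ[𝓝 x] fun z ↦ q (v z) - q (w z) := by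
    filter_upwards [deriv_sub_eq.deriv, hv.eventually_analyticAt, hw.eventually_analyticAt, hv_ode,
      hw_ode] with z h hv hw hv_ode hw_ode
    rw [h, deriv_sub hv.deriv.differentiableAt hw.deriv.differentiableAt, hv_ode, hw_ode]
    rfl
  have tendsto_prod : Tendsto (fun z ↦ (v z, w z)) (𝓝 x) (𝓝 (v x, v x)) :=
    (hv.continuousAt.prodMk hw.continuousAt).tendsto.trans_eq (by rw [h₀])
  refine (eventuallyEq_zero_of_deriv_deriv_isBigO (hv.sub hw) (by simp [h₀])
    (by simp [deriv_sub_eq.self_of_nhds, h₁]) ?_).mono fun z hz ↦ sub_eq_zero.1 hz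
  exact deriv_deriv_sub_eq.trans_isBigO (hq.isBigO_sub.comp_tendsto tendsto_prod)

variable [CompleteSpace 𝕜] {p v w : 𝕜 → 𝕜}

theorem deriv_deriv_eq_of_deriv_sq_eq_comp (hv : AnalyticAt 𝕜 v x) (hp : AnalyticAt 𝕜 p (v x))
    (v_nonconst : ¬ EventuallyConst v (𝓝 x)) (hode : deriv v ^ 2 =ᶠ[𝓝 x] p ∘ v) :
    deriv (deriv v) =ᶠ[𝓝 x] (fun y ↦ deriv p y / 2) ∘ v := by
  set d : 𝕜 → 𝕜 := fun z ↦ deriv (deriv v) z - deriv p (v z) / 2 with d_def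
  have d_analytic : AnalyticAt 𝕜 d x :=
    hv.deriv.deriv.sub ((hp.deriv.fun_comp hv).div analyticAt_const two_ne_zero)
  have deriv_mul_eq_zero : deriv v * d =ᶠ[𝓝 x] 0 := by
    filter_upwards [hode.deriv, hv.eventually_analyticAt,
      hv.continuousAt.eventually hp.eventually_analyticAt] with z hz hv hp
    rw [deriv_pow hv.deriv.differentiableAt,
      deriv_comp z hp.differentiableAt hv.differentiableAt] at hz
    simp only [d_def, Pi.mul_apply, Pi.zero_apply]
    linear_combination hz / 2
  have order_mul := analyticOrderAt_eq_top.2 deriv_mul_eq_zero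
  rw [analyticOrderAt_mul hv.deriv d_analytic, ENat.add_eq_top] at order_mul
  have order_deriv_ne_top : analyticOrderAt (deriv v) x ≠ ⊤ := fun h ↦ v_nonconst <| by
    rw [eventuallyConst_iff_analyticOrderAt_sub_eq_top, ← hv.analyticOrderAt_deriv_add_one, h,
      top_add]
  exact (analyticOrderAt_eq_top.1 (order_mul.resolve_left order_deriv_ne_top)).mono
    fun z hz ↦ sub_eq_zero.1 hz

/-- At a zero of `p` the first order equation also has a constant solution, so uniqueness comes from
the second order equation obtained by differentiating it. -/
theorem eventuallyEq_of_deriv_sq_eq_comp (hv : AnalyticAt 𝕜 v x) (hw : AnalyticAt 𝕜 w x)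
    (hp : AnalyticAt 𝕜 p (v x)) (hp₀ : p (v x) = 0) (h₀ : v x = w x)
    (v_nonconst : ¬ EventuallyConst v (𝓝 x)) (w_nonconst : ¬ EventuallyConst w (𝓝 x))
    (hv_ode : deriv v ^ 2 =ᶠ[𝓝 x] p ∘ v) (hw_ode : deriv w ^ 2 =ᶠ[𝓝 x] p ∘ w) :
    v =ᶠ[𝓝 x] w := by
  have deriv_v : deriv v x = 0 := by simpa [hp₀] using hv_ode.self_of_nhds
  have deriv_w : deriv w x = 0 := by simpa [← h₀, hp₀] using hw_ode.self_of_nhds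
  refine eventuallyEq_of_deriv_deriv_eq_comp hv hw
    (hp.deriv.div analyticAt_const two_ne_zero).hasStrictFDerivAt
    (deriv_deriv_eq_of_deriv_sq_eq_comp hv hp v_nonconst hv_ode)
    (deriv_deriv_eq_of_deriv_sq_eq_comp hw (h₀ ▸ hp) w_nonconst hw_ode) h₀ ?_
  rw [deriv_v, deriv_w]

end AnalyticODE

section DnTwo

variable {κ r : ℝ} {φ ψ : ℂ → ℂ}

theorem IsDnTwoData.analyticOnNhd_dnTwo (h : IsDnTwoData κ r φ ψ) :
    AnalyticOnNhd ℂ (dnTwo ψ) (Metric.ball 0 r) := fun z hz ↦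
  Complex.analyticAt_cos.comp (h.analytic_psi z hz)

theorem IsDnTwoData.dnTwo_zero (h : IsDnTwoData κ r φ ψ) : dnTwo ψ 0 = 1 := by
  rw [dnTwo, h.psi_zero, Complex.cos_zero]

theorem IsDnTwoData.eventually_mem_ball (h : IsDnTwoData κ r φ ψ) :
    ∀ᶠ z in 𝓝 0, z ∈ Metric.ball (0 : ℂ) r :=
  Metric.ball_mem_nhds 0 h.radius_pos

theorem IsDnTwoData.continuousAt_phi (h : IsDnTwoData κ r φ ψ) : ContinuousAt φ 0 :=
  (h.analytic_phi 0 (Metric.mem_ball_self h.radius_pos)).continuousAt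

theorem IsDnTwoData.continuousAt_psi (h : IsDnTwoData κ r φ ψ) : ContinuousAt ψ 0 :=
  (h.analytic_psi 0 (Metric.mem_ball_self h.radius_pos)).continuousAt

theorem IsDnTwoData.eventually_sigFourIntegrand_mul_deriv (h : IsDnTwoData κ r φ ψ) :
    ∀ᶠ z in 𝓝 0, sigFourIntegrand κ (φ z) * deriv φ z = 1 := by
  have hasDerivAt_integral : ∀ᶠ z in 𝓝 0,
      HasDerivAt (sigFourIntegral κ) (sigFourIntegrand κ (φ z)) (φ z) :=
    h.continuousAt_phi.eventually (by
      rw [h.phi_zero]; exact eventually_hasDerivAt_sigFourIntegral κ)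
  filter_upwards [hasDerivAt_integral, h.eventually_mem_ball, h.eventually_mem_ball.eventually_nhds]
    with z hz hmem hball
  exact (hz.comp z (h.analytic_phi z hmem).differentiableAt.hasDerivAt).unique
    ((hasDerivAt_id z).congr_of_eventuallyEq (hball.mono h.right_inv))

theorem IsDnTwoData.eventually_deriv_phi_mul_cos (h : IsDnTwoData κ r φ ψ) :
    ∀ᶠ z in 𝓝 0, deriv φ z * Complex.cos (ψ z / 2) = Complex.cos (ψ z) := by
  have hypergeometric_eq := h.continuousAt_psi.eventually (by
    rw [h.psi_zero]; exact eventually_ordinaryHypergeometric_quarter_sin_sq)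
  filter_upwards [h.eventually_sigFourIntegrand_mul_deriv, hypergeometric_eq,
    h.eventually_mem_ball] with z hφ hF hz
  rw [sigFourIntegrand, ← mul_pow, ← h.sin_psi z hz] at hφ
  rw [← hF]
  linear_combination Complex.cos (ψ z) * hφ

theorem IsDnTwoData.eventually_deriv_psi_mul_cos (h : IsDnTwoData κ r φ ψ) :
    ∀ᶠ z in 𝓝 0, deriv ψ z * Complex.cos (ψ z / 2) = κ * Complex.cos (φ z) := by
  have cos_ne_zero : ∀ᶠ z in 𝓝 0, Complex.cos (ψ z) ≠ 0 :=
    (Complex.continuous_cos.continuousAt.comp h.continuousAt_psi).eventually_ne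
      (by simp [h.psi_zero])
  filter_upwards [h.eventually_deriv_phi_mul_cos, cos_ne_zero, h.eventually_mem_ball,
    h.eventually_mem_ball.eventually_nhds] with z hφ hcos hz hball
  have hasDerivAt_sin_psi := (h.analytic_psi z hz).differentiableAt.hasDerivAt.csin
  have hasDerivAt_mul_sin_phi :=
    (h.analytic_phi z hz).differentiableAt.hasDerivAt.csin.const_mul (κ : ℂ)
  have deriv_sin := hasDerivAt_sin_psi.unique
    (hasDerivAt_mul_sin_phi.congr_of_eventuallyEq (hball.mono h.sin_psi))
  refine mul_left_cancel₀ hcos ?_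
  linear_combination Complex.cos (ψ z / 2) * deriv_sin + κ * Complex.cos (φ z) * hφ

theorem IsDnTwoData.eventually_hasDerivAt_sin_half (h : IsDnTwoData κ r φ ψ) :
    ∀ᶠ z in 𝓝 0, HasDerivAt (fun z ↦ Complex.sin (ψ z / 2)) (κ / 2 * Complex.cos (φ z)) z := by
  filter_upwards [h.eventually_deriv_psi_mul_cos, h.eventually_mem_ball] with z hψ hz
  convert ((h.analytic_psi z hz).differentiableAt.hasDerivAt.div_const 2).csin using 1
  linear_combination -hψ / 2

theorem dnTwo_eq_one_sub_sin_half_sq (ψ : ℂ → ℂ) (z : ℂ) :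
    dnTwo ψ z = 1 - 2 * Complex.sin (ψ z / 2) ^ 2 := by
  have cos_eq := Complex.cos_two_mul' (ψ z / 2)
  rw [mul_div_cancel₀ _ two_ne_zero] at cos_eq
  rw [dnTwo, cos_eq, Complex.cos_sq']
  ring

theorem IsDnTwoData.deriv_dnTwo_sq (h : IsDnTwoData κ r φ ψ) :
    deriv (dnTwo ψ) ^ 2 =ᶠ[𝓝 0]
      (fun y ↦ 2 * (1 - y) * (y ^ 2 - (1 - (κ : ℂ) ^ 2))) ∘ dnTwo ψ := by
  filter_upwards [h.eventually_hasDerivAt_sin_half, h.eventually_mem_ball] with z hderiv hz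
  have hderiv := ((hderiv.fun_pow 2).const_mul 2).const_sub 1
  rw [Pi.pow_apply, Function.comp_apply, funext (dnTwo_eq_one_sub_sin_half_sq ψ), hderiv.deriv]
  have pyth_ψ := Complex.sin_sq_add_cos_sq (ψ z)
  rw [← dnTwo, dnTwo_eq_one_sub_sin_half_sq, h.sin_psi z hz] at pyth_ψ
  push_cast
  linear_combination 4 * (κ : ℂ) ^ 2 * Complex.sin (ψ z / 2) ^ 2 * Complex.sin_sq_add_cos_sq (φ z)
    - 4 * Complex.sin (ψ z / 2) ^ 2 * pyth_ψ

theorem IsDnTwoData.not_eventuallyConst_dnTwo (h : IsDnTwoData κ r φ ψ) (hκ : κ ≠ 0) :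
    ¬ EventuallyConst (dnTwo ψ) (𝓝 0) := by
  intro hconst
  obtain ⟨c, hc⟩ := hconst.eventuallyEq_const
  have c_eq_one : c = 1 := hc.self_of_nhds.symm.trans h.dnTwo_zero
  have sin_half_eq_zero : (fun z ↦ Complex.sin (ψ z / 2)) =ᶠ[𝓝 0] 0 := by
    filter_upwards [hc] with z hz
    rw [c_eq_one, dnTwo_eq_one_sub_sin_half_sq] at hz
    simpa using hz
  have := h.eventually_hasDerivAt_sin_half.self_of_nhds.unique
    ((hasDerivAt_const 0 0).congr_of_eventuallyEq sin_half_eq_zero)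
  simp [h.phi_zero, hκ] at this

end DnTwo

section WeierstrassReciprocal

theorem eventually_notMem_lattice (L : PeriodPair) (x : ℂ) : ∀ᶠ z in 𝓝[≠] x, z ∉ L.lattice := by
  filter_upwards [nhdsWithin_le_nhds (L.compl_lattice_sdiff_singleton_mem_nhds x),
    self_mem_nhdsWithin] with z hz hzx hzL using hz ⟨hzL, hzx⟩

theorem hasDerivAt_weierstrassP (L : PeriodPair) {z : ℂ} (hz : z ∉ L.lattice) :
    HasDerivAt L.weierstrassP (L.derivWeierstrassP z) z := by
  rw [← L.deriv_weierstrassP]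
  exact (L.analyticOnNhd_weierstrassP z hz).differentiableAt.hasDerivAt

/-- The reciprocal of `c + ℘` near the origin, with its removable singularity there filled in: it is
obtained from `1 / (c + ℘)` by writing `℘ z = 1 / z² + ℘₀ z` with `℘₀` regular at the origin. -/
noncomputable def weierstrassPReciprocal (L : PeriodPair) (c z : ℂ) : ℂ :=
  z ^ 2 / (1 + z ^ 2 * (c + L.weierstrassPExcept 0 z))

theorem weierstrassPReciprocal_zero (L : PeriodPair) (c : ℂ) :
    weierstrassPReciprocal L c 0 = 0 := by
  simp [weierstrassPReciprocal]

theorem analyticAt_one_add_sq_mul_weierstrassPExcept (L : PeriodPair) (c : ℂ) :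
    AnalyticAt ℂ (fun z ↦ 1 + z ^ 2 * (c + L.weierstrassPExcept 0 z)) 0 := by
  have := L.analyticAt_weierstrassPExcept 0
  fun_prop

theorem analyticAt_weierstrassPReciprocal (L : PeriodPair) (c : ℂ) :
    AnalyticAt ℂ (weierstrassPReciprocal L c) 0 :=
  (analyticAt_id.pow 2).div (analyticAt_one_add_sq_mul_weierstrassPExcept L c) (by simp)

theorem eventually_weierstrassPReciprocal_mul (L : PeriodPair) (c : ℂ) :
    ∀ᶠ z in 𝓝[≠] 0, weierstrassPReciprocal L c z * (c + L.weierstrassP z) = 1 := by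
  have denom_ne_zero : ∀ᶠ z in 𝓝 (0 : ℂ), 1 + z ^ 2 * (c + L.weierstrassPExcept 0 z) ≠ 0 :=
    (analyticAt_one_add_sq_mul_weierstrassPExcept L c).continuousAt.eventually_ne (by simp)
  filter_upwards [nhdsWithin_le_nhds denom_ne_zero, self_mem_nhdsWithin] with z hz (hz₀ : z ≠ 0)
  have weierstrassP_eq : L.weierstrassP z = L.weierstrassPExcept 0 z + 1 / z ^ 2 := by
    simpa using (L.weierstrassPExcept_add 0 z).symm
  rw [weierstrassPReciprocal, div_mul_eq_mul_div, div_eq_one_iff_eq hz, weierstrassP_eq]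
  field

theorem not_eventuallyConst_weierstrassPReciprocal (L : PeriodPair) (c : ℂ) :
    ¬ EventuallyConst (weierstrassPReciprocal L c) (𝓝 0) := by
  intro hconst
  obtain ⟨a, ha⟩ := hconst.eventuallyEq_const
  have a_eq_zero : a = 0 := ha.self_of_nhds.symm.trans (weierstrassPReciprocal_zero L c)
  obtain ⟨z, hz, hmul⟩ :=
    ((ha.filter_mono nhdsWithin_le_nhds).and (eventually_weierstrassPReciprocal_mul L c)).exists
  rw [hz, a_eq_zero, zero_mul] at hmul
  exact zero_ne_one hmul

theorem deriv_weierstrassPReciprocal_sq (L : PeriodPair) (c : ℂ) :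
    deriv (weierstrassPReciprocal L c) ^ 2 =ᶠ[𝓝 0]
      (fun y ↦ 4 * y - 12 * c * y ^ 2 + (12 * c ^ 2 - L.g₂) * y ^ 3 +
        (L.g₂ * c - 4 * c ^ 3 - L.g₃) * y ^ 4) ∘ weierstrassPReciprocal L c := by
  have h_analytic := analyticAt_weierstrassPReciprocal L c
  refine ((h_analytic.deriv.pow 2).continuousAt.eventuallyEq_nhds_iff_eventuallyEq_nhdsNE
    (ContinuousAt.comp (by fun_prop) h_analytic.continuousAt)).1 ?_
  have hmul := eventually_weierstrassPReciprocal_mul L c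
  filter_upwards [hmul, eventually_eventually_nhdsWithin.2 hmul, eventually_notMem_lattice L 0,
    self_mem_nhdsWithin] with z hz hz_nhds hzL hz₀
  have weierstrassP_ne : c + L.weierstrassP z ≠ 0 := right_ne_zero_of_mul_eq_one hz
  rw [isOpen_compl_singleton.nhdsWithin_eq hz₀] at hz_nhds
  have eq_inv : weierstrassPReciprocal L c =ᶠ[𝓝 z] fun w ↦ (c + L.weierstrassP w)⁻¹ :=
    hz_nhds.mono fun w hw ↦ eq_inv_of_mul_eq_one_left hw
  have hderiv := ((hasDerivAt_weierstrassP L hzL).const_add c).fun_inv weierstrassP_ne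
  have weierstrass_eq := L.derivWeierstrassP_sq z hzL
  simp only [Pi.pow_apply, Function.comp_apply]
  rw [eq_inv.deriv_eq, hderiv.deriv, eq_inv.self_of_nhds, div_pow, neg_sq, weierstrass_eq]
  field

end WeierstrassReciprocal

section Identity

theorem complementaryModulus_sq {κ : ℝ} (hκ : κ ^ 2 ≤ 1) :
    complementaryModulus κ ^ 2 = 1 - κ ^ 2 :=
  Real.sq_sqrt (sub_nonneg.2 hκ)

theorem HasDnTwoInvariants.deriv_weierstrassPReciprocal_sq {κ : ℝ} {L : PeriodPair}
    (hL : HasDnTwoInvariants κ L) (hκ : κ ^ 2 ≤ 1) :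
    deriv (weierstrassPReciprocal L (1 / 3)) ^ 2 =ᶠ[𝓝 0]
      (fun y ↦ 4 * y - 4 * y ^ 2 + (κ : ℂ) ^ 2 * y ^ 3) ∘ weierstrassPReciprocal L (1 / 3) := by
  convert _root_.deriv_weierstrassPReciprocal_sq L (1 / 3) using 3 with y
  rw [hL.1, hL.2, ← Complex.ofReal_pow (complementaryModulus κ), complementaryModulus_sq hκ]
  push_cast
  ring

theorem HasDnTwoInvariants.deriv_one_sub_mul_weierstrassPReciprocal_sq {κ : ℝ} {L : PeriodPair}
    (hL : HasDnTwoInvariants κ L) (hκ : κ ^ 2 ≤ 1) :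
    deriv (fun z ↦ 1 - (κ : ℂ) ^ 2 / 2 * weierstrassPReciprocal L (1 / 3) z) ^ 2 =ᶠ[𝓝 0]
      (fun y ↦ 2 * (1 - y) * (y ^ 2 - (1 - (κ : ℂ) ^ 2))) ∘
        fun z ↦ 1 - (κ : ℂ) ^ 2 / 2 * weierstrassPReciprocal L (1 / 3) z := by
  filter_upwards [hL.deriv_weierstrassPReciprocal_sq hκ] with z hz
  rw [Pi.pow_apply, Function.comp_apply] at hz ⊢
  rw [deriv_const_sub, deriv_const_mul_field, neg_sq, mul_pow, hz]
  ring

variable {κ r : ℝ} {φ ψ : ℂ → ℂ} {L : PeriodPair}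

theorem IsDnTwoData.dnTwo_eventuallyEq (h : IsDnTwoData κ r φ ψ) (hL : HasDnTwoInvariants κ L)
    (hκ₀ : κ ≠ 0) (hκ₁ : κ ^ 2 ≤ 1) :
    dnTwo ψ =ᶠ[𝓝 0] fun z ↦ 1 - (κ : ℂ) ^ 2 / 2 * weierstrassPReciprocal L (1 / 3) z := by
  have factor_ne_zero : (κ : ℂ) ^ 2 / 2 ≠ 0 := by simpa using hκ₀
  refine eventuallyEq_of_deriv_sq_eq_comp
    (h.analyticOnNhd_dnTwo 0 (Metric.mem_ball_self h.radius_pos))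
    (analyticAt_const.sub (analyticAt_const.mul (analyticAt_weierstrassPReciprocal L (1 / 3))))
    (by fun_prop) (by simp [h.dnTwo_zero]) (by simp [h.dnTwo_zero, weierstrassPReciprocal_zero])
    (h.not_eventuallyConst_dnTwo hκ₀) (fun hconst ↦ ?_) h.deriv_dnTwo_sq
    (hL.deriv_one_sub_mul_weierstrassPReciprocal_sq hκ₁)
  refine not_eventuallyConst_weierstrassPReciprocal L (1 / 3) ?_
  convert hconst.comp fun y ↦ (1 - y) / ((κ : ℂ) ^ 2 / 2) using 1
  funext z
  rw [Function.comp_apply, sub_sub_cancel, mul_div_cancel_left₀ _ factor_ne_zero]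

theorem IsDnTwoData.eventually_one_sub_dnTwo_mul (h : IsDnTwoData κ r φ ψ)
    (hL : HasDnTwoInvariants κ L) (hκ₀ : κ ≠ 0) (hκ₁ : κ ^ 2 ≤ 1) :
    ∀ᶠ z in 𝓝[≠] (0 : ℂ), (1 - dnTwo ψ z) * (1 / 3 + L.weierstrassP z) = (κ : ℂ) ^ 2 / 2 := by
  filter_upwards [nhdsWithin_le_nhds (h.dnTwo_eventuallyEq hL hκ₀ hκ₁),
    eventually_weierstrassPReciprocal_mul L (1 / 3)] with z hz hmul
  rw [hz, sub_sub_cancel, mul_assoc, hmul, mul_one]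

theorem eq_zero_of_meromorphicOn_of_eventually_eq_zero {𝕜 E : Type*} [NontriviallyNormedField 𝕜]
    [NormedAddCommGroup E] [NormedSpace 𝕜 E] {f : 𝕜 → E} {U : Set 𝕜} (hf : MeromorphicOn f U)
    (hU : IsPreconnected U) {x z : 𝕜} (hx : x ∈ U) (hz : z ∈ U) (hfx : ∀ᶠ w in 𝓝[≠] x, f w = 0)
    (hfz : ContinuousAt f z) : f z = 0 := by
  have order_eq_top : meromorphicOrderAt f z = ⊤ := by
    by_contra order_ne_top
    exact hf.meromorphicOrderAt_ne_top_of_isPreconnected hU hz hx order_ne_top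
      (meromorphicOrderAt_eq_top_iff.2 hfx)
  exact ((hfz.eventuallyEq_nhds_iff_eventuallyEq_nhdsNE continuousAt_const).1
    (meromorphicOrderAt_eq_top_iff.1 order_eq_top)).self_of_nhds

theorem IsDnTwoData.one_sub_dnTwo_mul (h : IsDnTwoData κ r φ ψ) (hL : HasDnTwoInvariants κ L)
    (hκ₀ : κ ≠ 0) (hκ₁ : κ ^ 2 ≤ 1) {z : ℂ} (hz : z ∈ Metric.ball (0 : ℂ) r)
    (hzL : z ∉ L.lattice) :
    (1 - dnTwo ψ z) * (1 / 3 + L.weierstrassP z) = (κ : ℂ) ^ 2 / 2 := by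
  have meromorphicOn_sub : MeromorphicOn
      (fun z ↦ (1 - dnTwo ψ z) * (1 / 3 + L.weierstrassP z) - (κ : ℂ) ^ 2 / 2)
      (Metric.ball 0 r) := fun w hw ↦ by
    have := (h.analyticOnNhd_dnTwo w hw).meromorphicAt
    have := L.meromorphic_weierstrassP w
    fun_prop
  have continuousAt_dnTwo := (h.analyticOnNhd_dnTwo z hz).continuousAt
  have continuousAt_weierstrassP := (L.analyticOnNhd_weierstrassP z hzL).continuousAt
  exact sub_eq_zero.1 <| eq_zero_of_meromorphicOn_of_eventually_eq_zero meromorphicOn_sub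
    (convex_ball 0 r).isPreconnected (Metric.mem_ball_self h.radius_pos) hz
    ((h.eventually_one_sub_dnTwo_mul hL hκ₀ hκ₁).mono fun w hw ↦ sub_eq_zero.2 hw) (by fun_prop)

end Identity

section EllipticExtension

/-- The elliptic function `1 - (κ² / 2) / (1/3 + ℘)` extending `dn₂`, in normal form: its removable
singularities, among them the lattice points, are filled in. -/
noncomputable def ellipticDnTwo (κ : ℝ) (L : PeriodPair) : ℂ → ℂ :=
  toMeromorphicNFOn (fun z ↦ 1 - (κ : ℂ) ^ 2 / 2 / (1 / 3 + L.weierstrassP z)) Set.univ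

variable {κ r : ℝ} {φ ψ : ℂ → ℂ} {L : PeriodPair}

theorem meromorphicNFOn_ellipticDnTwo (κ : ℝ) (L : PeriodPair) :
    MeromorphicNFOn (ellipticDnTwo κ L) Set.univ :=
  meromorphicNFOn_toMeromorphicNFOn _ _

theorem ellipticDnTwo_eventuallyEq (κ : ℝ) (L : PeriodPair) (z : ℂ) :
    ellipticDnTwo κ L =ᶠ[𝓝[≠] z] fun z ↦ 1 - (κ : ℂ) ^ 2 / 2 / (1 / 3 + L.weierstrassP z) := by
  refine MeromorphicOn.toMeromorphicNFOn_eq_self_on_nhdsNE (fun w _ ↦ ?_) (Set.mem_univ z)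
  have := L.meromorphic_weierstrassP w
  fun_prop

theorem ellipticDnTwo_eq_of_analyticAt {f : ℂ → ℂ} {z : ℂ} (hf : AnalyticAt ℂ f z)
    (h : ∀ᶠ w in 𝓝[≠] z, f w = 1 - (κ : ℂ) ^ 2 / 2 / (1 / 3 + L.weierstrassP w)) :
    ellipticDnTwo κ L z = f z :=
  (((meromorphicNFOn_ellipticDnTwo κ L (Set.mem_univ z)).eventuallyEq_nhdsNE_iff_eventuallyEq_nhds
    hf.meromorphicNFAt).1
      ((ellipticDnTwo_eventuallyEq κ L z).trans (EventuallyEq.symm h))).self_of_nhds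

theorem periodic_of_meromorphicNFOn_of_eventuallyEq {𝕜 E : Type*} [NontriviallyNormedField 𝕜]
    [NormedAddCommGroup E] [NormedSpace 𝕜 E] {f g : 𝕜 → E} {c : 𝕜}
    (hf : MeromorphicNFOn f Set.univ) (hfg : ∀ z, f =ᶠ[𝓝[≠] z] g) (hg : Function.Periodic g c) :
    Function.Periodic f c := fun z ↦ by
  have shift_nf : MeromorphicNFAt (f ∘ (· + c)) z :=
    meromorphicNFAt_comp_add_const_iff_meromorphicNFAt.2 (hf (Set.mem_univ _))
  have shift_tendsto : Tendsto (· + c) (𝓝[≠] z) (𝓝[≠] (z + c)) :=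
    (continuous_add_const c).continuousAt.continuousWithinAt.tendsto_nhdsWithin fun w hw ↦ by
      simpa using hw
  refine ((shift_nf.eventuallyEq_nhdsNE_iff_eventuallyEq_nhds (hf (Set.mem_univ z))).1
    ?_).self_of_nhds
  filter_upwards [shift_tendsto.eventually (hfg (z + c)), hfg z] with w hwc hw
  rw [Function.comp_apply, hwc, hw, hg]

theorem isEllipticFor_ellipticDnTwo (κ : ℝ) (L : PeriodPair) :
    IsEllipticFor L (ellipticDnTwo κ L) :=
  ⟨meromorphicNFOn_ellipticDnTwo κ L, fun l hl ↦
    periodic_of_meromorphicNFOn_of_eventuallyEq (meromorphicNFOn_ellipticDnTwo κ L)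
      (ellipticDnTwo_eventuallyEq κ L) fun z ↦ by rw [L.weierstrassP_add_coe z ⟨l, hl⟩]⟩

theorem IsDnTwoData.eqOn_ellipticDnTwo (h : IsDnTwoData κ r φ ψ) (hL : HasDnTwoInvariants κ L)
    (hκ₀ : κ ≠ 0) (hκ₁ : κ ^ 2 ≤ 1) :
    Set.EqOn (ellipticDnTwo κ L) (dnTwo ψ) (Metric.ball 0 r) := by
  intro z hz
  refine ellipticDnTwo_eq_of_analyticAt (h.analyticOnNhd_dnTwo z hz) ?_
  filter_upwards [eventually_notMem_lattice L z,
    nhdsWithin_le_nhds (Metric.isOpen_ball.mem_nhds hz)] with w hwL hw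
  have identity := h.one_sub_dnTwo_mul hL hκ₀ hκ₁ hw hwL
  have weierstrassP_ne : 1 / 3 + L.weierstrassP w ≠ 0 :=
    right_ne_zero_of_mul (identity.trans_ne (by simpa using hκ₀))
  rw [← identity, mul_div_cancel_right₀ _ weierstrassP_ne, sub_sub_cancel]

theorem one_sub_ellipticDnTwo_mul (κ : ℝ) {z : ℂ} (hz : z ∉ L.lattice)
    (hne : 1 / 3 + L.weierstrassP z ≠ 0) :
    (1 - ellipticDnTwo κ L z) * (1 / 3 + L.weierstrassP z) = (κ : ℂ) ^ 2 / 2 := by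
  have analyticAt_formula :
      AnalyticAt ℂ (fun z ↦ 1 - (κ : ℂ) ^ 2 / 2 / (1 / 3 + L.weierstrassP z)) z :=
    analyticAt_const.sub
      (analyticAt_const.div (analyticAt_const.add (L.analyticOnNhd_weierstrassP z hz)) hne)
  rw [ellipticDnTwo_eq_of_analyticAt analyticAt_formula (Eventually.of_forall fun _ ↦ rfl),
    sub_sub_cancel, div_mul_cancel₀ _ hne]

end EllipticExtension

section LatticeExistence

open UpperHalfPlane ModularForm EisensteinSeries CongruenceSubgroup
open scoped MatrixGroups

/-- The period pair `(c ω₁, c ω₂)`, which spans the lattice `c Λ`. -/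
noncomputable def scaledPeriodPair (L : PeriodPair) {c : ℂ} (hc : c ≠ 0) : PeriodPair where
  ω₁ := c * L.ω₁
  ω₂ := c * L.ω₂
  indep := by
    refine LinearIndependent.pair_iff.2 fun s t hst ↦
      LinearIndependent.pair_iff.1 L.indep s t (mul_left_cancel₀ hc ?_)
    rw [mul_zero, ← hst, mul_add, mul_smul_comm, mul_smul_comm]

theorem G_scaledPeriodPair (L : PeriodPair) {c : ℂ} (hc : c ≠ 0) (n : ℕ) :
    (scaledPeriodPair L hc).G n = (c ^ n)⁻¹ * L.G n := by
  let e : L.lattice ≃ (scaledPeriodPair L hc).lattice :=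
    (Equiv.mulLeft₀ c hc).subtypeEquiv fun x ↦ by
      simp only [PeriodPair.mem_lattice, scaledPeriodPair, Equiv.mulLeft₀_apply, mul_left_comm _ c,
        ← mul_add, mul_right_inj' hc]
  rw [PeriodPair.G, PeriodPair.G, ← e.tsum_eq, ← tsum_mul_left]
  exact tsum_congr fun x ↦ by simp [e, mul_pow, mul_comm]

theorem g₂_scaledPeriodPair (L : PeriodPair) {c : ℂ} (hc : c ≠ 0) :
    (scaledPeriodPair L hc).g₂ = L.g₂ / c ^ 4 := by
  rw [PeriodPair.g₂, PeriodPair.g₂, G_scaledPeriodPair]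
  ring

theorem g₃_scaledPeriodPair (L : PeriodPair) {c : ℂ} (hc : c ≠ 0) :
    (scaledPeriodPair L hc).g₃ = L.g₃ / c ^ 6 := by
  rw [PeriodPair.g₃, PeriodPair.g₃, G_scaledPeriodPair]
  ring

theorem exists_g₂_g₃_eq_of_sq_mul_cube_eq {L : PeriodPair} {a b : ℂ} (hL : L.g₂ ≠ 0) (ha : a ≠ 0)
    (h : L.g₃ ^ 2 * a ^ 3 = b ^ 2 * L.g₂ ^ 3) : ∃ L' : PeriodPair, L'.g₂ = a ∧ L'.g₃ = b := by
  obtain ⟨c, hc⟩ := IsAlgClosed.exists_pow_nat_eq (L.g₂ / a) (n := 4) (by norm_num)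
  have c_ne_zero : c ≠ 0 := by
    rintro rfl
    exact div_ne_zero hL ha (by simpa using hc.symm)
  have g₂_eq : L.g₂ / c ^ 4 = a := by rw [hc, div_div_cancel₀ hL]
  have g₃_sq_eq : (L.g₃ / c ^ 6) ^ 2 = b ^ 2 := by
    have c_pow : (c ^ 6) ^ 2 = (L.g₂ / a) ^ 3 := by rw [← hc]; ring
    rw [div_pow, c_pow, div_pow, div_div_eq_mul_div, h, mul_div_cancel_right₀ _ (pow_ne_zero 3 hL)]
  rcases sq_eq_sq_iff_eq_or_eq_neg.1 g₃_sq_eq with g₃_eq | g₃_eq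
  · exact ⟨scaledPeriodPair L c_ne_zero, (g₂_scaledPeriodPair L c_ne_zero).trans g₂_eq,
      (g₃_scaledPeriodPair L c_ne_zero).trans g₃_eq⟩
  · -- Multiplying `c` by `i` preserves `c ^ 4` and changes the sign of `c ^ 6`.
    have I_mul_c_ne_zero := mul_ne_zero Complex.I_ne_zero c_ne_zero
    have I_pow_six : Complex.I ^ 6 = -1 := by rw [Complex.I_pow_eq_pow_mod, Complex.I_sq]
    refine ⟨scaledPeriodPair L I_mul_c_ne_zero, ?_, ?_⟩
    · rw [g₂_scaledPeriodPair, mul_pow, Complex.I_pow_four, one_mul, g₂_eq]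
    · rw [g₃_scaledPeriodPair, mul_pow, I_pow_six, neg_one_mul, div_neg, g₃_eq, neg_neg]

/-- The period pair `(τ, 1)`, which spans the lattice `ℤτ + ℤ`. -/
noncomputable def upperHalfPlanePeriodPair (τ : ℍ) : PeriodPair where
  ω₁ := τ
  ω₂ := 1
  indep := by
    refine LinearIndependent.pair_iff.2 fun s t hst ↦ ?_
    have hs : s = 0 := by simpa [τ.im_ne_zero] using congrArg Complex.im hst
    exact ⟨hs, by simpa [hs] using hst⟩

theorem G_upperHalfPlanePeriodPair_eq_tsum_eisSummand (k : ℕ) (τ : ℍ) :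
    (upperHalfPlanePeriodPair τ).G k = ∑' v, eisSummand k v τ := by
  rw [PeriodPair.G, ← (upperHalfPlanePeriodPair τ).latticeEquivProd.symm.toEquiv.tsum_eq,
    ← (finTwoArrowEquiv ℤ).tsum_eq]
  refine tsum_congr fun v ↦ ?_
  rw [finTwoArrowEquiv_apply, LinearEquiv.coe_toEquiv, PeriodPair.latticeEquiv_symm_apply]
  simp [upperHalfPlanePeriodPair, eisSummand]

theorem G_upperHalfPlanePeriodPair {k : ℕ} (hk : 3 ≤ k) (τ : ℍ) :
    (upperHalfPlanePeriodPair τ).G k = 2 * riemannZeta k * E hk τ := by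
  have E_eq : E hk τ = 1 / 2 * eisensteinSeries (N := 1) 0 k τ := rfl
  rw [G_upperHalfPlanePeriodPair_eq_tsum_eisSummand,
    tsum_eisSummand_eq_riemannZeta_mul_eisensteinSeries hk, E_eq]
  ring

theorem bernoulli_six : bernoulli 6 = 1 / 42 := by
  rw [bernoulli_eq_bernoulli'_of_ne_one (by norm_num), bernoulli'_def]
  have choose_six_two : Nat.choose 6 2 = 15 := by decide
  have choose_six_four : Nat.choose 6 4 = 15 := by decide
  norm_num [Finset.sum_range_succ, choose_six_two, choose_six_four,
    bernoulli'_eq_zero_of_odd (n := 5) (by decide)]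

theorem riemannZeta_six : riemannZeta 6 = (Real.pi : ℂ) ^ 6 / 945 := by
  have h := riemannZeta_two_mul_nat (k := 3) (by norm_num)
  have factorial_six : Nat.factorial 6 = 720 := by decide
  push_cast [bernoulli_six, factorial_six] at h
  norm_num1 at h
  rw [h]
  ring

theorem g₂_upperHalfPlanePeriodPair (τ : ℍ) :
    (upperHalfPlanePeriodPair τ).g₂ = 4 * (Real.pi : ℂ) ^ 4 / 3 * E₄ τ := by
  rw [PeriodPair.g₂, G_upperHalfPlanePeriodPair (by norm_num), Nat.cast_ofNat, riemannZeta_four]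
  ring

theorem g₃_upperHalfPlanePeriodPair (τ : ℍ) :
    (upperHalfPlanePeriodPair τ).g₃ = 8 * (Real.pi : ℂ) ^ 6 / 27 * E₆ τ := by
  rw [PeriodPair.g₃, G_upperHalfPlanePeriodPair (by norm_num), Nat.cast_ofNat, riemannZeta_six]
  ring

theorem apply_I_eq_zero_of_I_zpow_ne_one {F : Type*} [FunLike F ℍ ℂ] {k : ℤ}
    [SlashInvariantFormClass F 𝒮ℒ k] (f : F) (hk : Complex.I ^ k ≠ 1) : f I = 0 := by
  have S_smul_I : ModularGroup.S • I = I := by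
    rw [modular_S_smul]
    ext1
    simp
  have : SlashInvariantFormClass F Γ(1) k := Gamma_one_coe_eq_SL ▸ ‹_›
  have apply_S_smul := SlashInvariantForm.slash_action_eqn_SL'' f
    (mem_Gamma_one ModularGroup.S) I
  rw [S_smul_I, ModularGroup.denom_S, coe_I] at apply_S_smul
  have sub_mul_apply_I : (1 - Complex.I ^ k) * f I = 0 := by linear_combination apply_S_smul
  exact (mul_eq_zero.1 sub_mul_apply_I).resolve_left (sub_ne_zero.2 hk.symm)

theorem E₆_apply_I : E₆ I = 0 := by
  refine apply_I_eq_zero_of_I_zpow_ne_one E₆ ?_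
  rw [zpow_ofNat, Complex.I_pow_eq_pow_mod, Complex.I_sq]
  norm_num

theorem tendsto_atImInfty_coeff_zero {F : Type*} [FunLike F ℍ ℂ] {Γ : Subgroup (GL (Fin 2) ℝ)}
    {k : ℤ} [ModularFormClass F Γ k] (f : F) {h : ℝ} (hh : 0 < h) (hΓ : h ∈ Γ.strictPeriods) :
    Tendsto f atImInfty (𝓝 ((qExpansion h f).coeff 0)) := by
  have cuspFunction_comp : cuspFunction h f ∘ (fun τ : ℍ ↦ Function.Periodic.qParam h τ) = f :=
    funext fun τ ↦ SlashInvariantFormClass.eq_cuspFunction f τ hΓ hh.ne'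
  have cuspFunction_zero : cuspFunction h f 0 = (qExpansion h f).coeff 0 := by
    simp [qExpansion_coeff]
  have tendsto_comp :=
    (ModularFormClass.analyticAt_cuspFunction_zero f hh hΓ).continuousAt.tendsto.comp
      (qParam_tendsto_atImInfty hh)
  rwa [cuspFunction_comp, cuspFunction_zero] at tendsto_comp

theorem tendsto_E_ofComplex_I_mul {k : ℕ} (hk : 3 ≤ k) (hk_even : Even k) :
    Tendsto (fun t : ℝ ↦ E hk (ofComplex (Complex.I * t))) atTop (𝓝 1) := by
  have tendsto_comap_im : Tendsto (fun t : ℝ ↦ Complex.I * t) atTop (comap Complex.im atTop) :=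
    tendsto_comap_iff.2 (tendsto_id.congr fun t ↦ by simp)
  have tendsto_E := tendsto_atImInfty_coeff_zero (E hk) one_pos one_mem_strictPeriods_SL
  rw [E_qExpansion_coeff_zero hk hk_even] at tendsto_E
  exact tendsto_E.comp (tendsto_comap_im_ofComplex.comp tendsto_comap_im)

theorem E_ofComplex_I_mul {k : ℕ} (hk : 3 ≤ k) (hk_even : Even k) {t : ℝ} (ht : 0 < t) :
    E hk (ofComplex (Complex.I * t)) =
      ((1 - 2 * k / bernoulli k * ∑' n : ℕ+, ArithmeticFunction.sigma (k - 1) n *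
        Real.exp (-(2 * Real.pi * t)) ^ (n : ℕ) : ℝ) : ℂ) := by
  have exp_eq : Complex.exp (2 * Real.pi * Complex.I * (ofComplex (Complex.I * t) : ℍ)) =
      (Real.exp (-(2 * Real.pi * t)) : ℂ) := by
    rw [ofComplex_apply_of_im_pos (by simpa using ht), coe_mk, Complex.ofReal_exp]
    congr 1
    push_cast
    linear_combination 2 * Real.pi * t * Complex.I_mul_I
  rw [q_expansion_bernoulli hk hk_even, exp_eq]
  push_cast
  simp only [zpow_natCast]

theorem ofReal_re_E_ofComplex_I_mul {k : ℕ} (hk : 3 ≤ k) (hk_even : Even k) {t : ℝ} (ht : 0 < t) :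
    ((E hk (ofComplex (Complex.I * t))).re : ℂ) = E hk (ofComplex (Complex.I * t)) := by
  rw [E_ofComplex_I_mul hk hk_even ht, Complex.ofReal_re]

theorem one_le_re_E₄_ofComplex_I_mul {t : ℝ} (ht : 0 < t) :
    1 ≤ (E₄ (ofComplex (Complex.I * t))).re := by
  have bernoulli_four : bernoulli 4 = -1 / 30 := by
    rw [bernoulli_eq_bernoulli'_of_ne_one (by norm_num), bernoulli'_four]
  rw [E_ofComplex_I_mul _ (by decide) ht, Complex.ofReal_re, bernoulli_four, sub_eq_add_neg,
    ← neg_mul, le_add_iff_nonneg_right]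
  exact mul_nonneg (by norm_num) (tsum_nonneg fun n ↦ by positivity)

theorem exists_mul_E₄_cube_eq_mul_E₆_sq {a b : ℝ} (hab : 27 * b ^ 2 < a ^ 3) :
    ∃ t : ℝ, 0 < t ∧ 27 * (b : ℂ) ^ 2 * E₄ (ofComplex (Complex.I * t)) ^ 3 =
      (a : ℂ) ^ 3 * E₆ (ofComplex (Complex.I * t)) ^ 2 := by
  let e₄ (t : ℝ) : ℝ := (E₄ (ofComplex (Complex.I * t))).re
  let e₆ (t : ℝ) : ℝ := (E₆ (ofComplex (Complex.I * t))).re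
  have continuousOn_re {k : ℕ} (hk : 3 ≤ k) :
      ContinuousOn (fun t : ℝ ↦ (E hk (ofComplex (Complex.I * t))).re) (Set.Ici 1) :=
    (Complex.continuous_re.comp (ModularFormClass.continuous (E hk))).comp_continuousOn
      (continuousOn_ofComplex_I_mul.mono (Set.Ici_subset_Ioi.2 one_pos))
  have tendsto_re {k : ℕ} (hk : 3 ≤ k) (hk_even : Even k) :
      Tendsto (fun t : ℝ ↦ (E hk (ofComplex (Complex.I * t))).re) atTop (𝓝 1) :=
    (Complex.continuous_re.tendsto 1).comp (tendsto_E_ofComplex_I_mul hk hk_even)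
  have continuousOn_diff : ContinuousOn (fun t ↦ 27 * b ^ 2 * e₄ t ^ 3 - a ^ 3 * e₆ t ^ 2)
      (Set.Ici 1) :=
    (((continuousOn_re _).pow 3).const_mul _).sub (((continuousOn_re _).pow 2).const_mul _)
  have tendsto_diff : Tendsto (fun t ↦ 27 * b ^ 2 * e₄ t ^ 3 - a ^ 3 * e₆ t ^ 2) atTop
      (𝓝 (27 * b ^ 2 * 1 ^ 3 - a ^ 3 * 1 ^ 2)) :=
    (((tendsto_re _ (by decide)).pow 3).const_mul _).sub
      (((tendsto_re _ (by decide)).pow 2).const_mul _)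
  have e₆_one : e₆ 1 = 0 := by
    have ofComplex_I : ofComplex (Complex.I * (1 : ℝ)) = I := by
      rw [Complex.ofReal_one, mul_one, ← coe_I, ofComplex_apply]
    simp only [e₆, ofComplex_I, E₆_apply_I, Complex.zero_re]
  have diff_one_nonneg : 0 ≤ 27 * b ^ 2 * e₄ 1 ^ 3 - a ^ 3 * e₆ 1 ^ 2 := by
    have : 0 ≤ e₄ 1 := zero_le_one.trans (one_le_re_E₄_ofComplex_I_mul one_pos)
    rw [e₆_one, zero_pow two_ne_zero, mul_zero, sub_zero]
    positivity
  obtain ⟨t, ht, diff_eq_zero⟩ := isPreconnected_Ici.intermediate_value_Ioc Set.self_mem_Ici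
    (le_principal_iff.2 (Ici_mem_atTop 1)) continuousOn_diff tendsto_diff
    ⟨by linarith, diff_one_nonneg⟩
  have ht : 0 < t := one_pos.trans_le ht
  refine ⟨t, ht, ?_⟩
  rw [← ofReal_re_E_ofComplex_I_mul (k := 4) _ (by decide) ht,
    ← ofReal_re_E_ofComplex_I_mul (k := 6) _ (by decide) ht]
  exact_mod_cast sub_eq_zero.1 diff_eq_zero

theorem exists_g₂_g₃_eq {a b : ℝ} (hab : 27 * b ^ 2 < a ^ 3) :
    ∃ L : PeriodPair, L.g₂ = a ∧ L.g₃ = b := by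
  have a_ne_zero : a ≠ 0 := by
    rintro rfl
    nlinarith
  obtain ⟨t, ht, E_eq⟩ := exists_mul_E₄_cube_eq_mul_E₆_sq hab
  refine exists_g₂_g₃_eq_of_sq_mul_cube_eq
    (L := upperHalfPlanePeriodPair (ofComplex (Complex.I * t))) ?_
    (Complex.ofReal_ne_zero.2 a_ne_zero) ?_
  · have E₄_ne_zero : E₄ (ofComplex (Complex.I * t)) ≠ 0 := fun h ↦ by
      have := one_le_re_E₄_ofComplex_I_mul ht
      norm_num [h] at this
    rw [g₂_upperHalfPlanePeriodPair]
    simp [E₄_ne_zero, Real.pi_ne_zero]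
  · rw [g₂_upperHalfPlanePeriodPair, g₃_upperHalfPlanePeriodPair]
    linear_combination -(64 * (Real.pi : ℂ) ^ 12 / 729) * E_eq

theorem exists_hasDnTwoInvariants {κ : ℝ} (hκ₀ : κ ≠ 0) (hκ₁ : κ ^ 2 < 1) :
    ∃ L : PeriodPair, HasDnTwoInvariants κ L := by
  have discriminant_pos : 0 < κ ^ 4 * (1 - κ ^ 2) := mul_pos (by positivity) (sub_pos.2 hκ₁)
  obtain ⟨L, hg₂, hg₃⟩ :=
    exists_g₂_g₃_eq (a := 4 / 3 - κ ^ 2) (b := 8 / 27 - κ ^ 2 / 3) (by linarith)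
  refine ⟨L, ?_, ?_⟩
  · rw [hg₂, ← Complex.ofReal_pow, complementaryModulus_sq hκ₁.le]
    push_cast
    ring
  · rw [hg₃, ← Complex.ofReal_pow, complementaryModulus_sq hκ₁.le]
    push_cast
    ring

end LatticeExistence

theorem mainTheorem4 (κ : ℝ) (hκ₀ : 0 < κ) (hκ₁ : κ < 1) :
    -- the local construction of `dn₂` is possible
    (∃ (r : ℝ) (φ ψ : ℂ → ℂ), IsDnTwoData κ r φ ψ) ∧
    -- the Weierstrass function with the stated invariants exists
    (∃ L : PeriodPair, HasDnTwoInvariants κ L) ∧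
    -- the two forms of the invariants agree
    complementaryModulus κ ^ 2 + 1 / 3 = 4 / 3 - κ ^ 2 ∧
    complementaryModulus κ ^ 2 / 3 - 1 / 27 = 8 / 27 - κ ^ 2 / 3 ∧
    ∀ L : PeriodPair, HasDnTwoInvariants κ L →
      -- the identity in the disc of definition, away from the poles of `℘`
      (∀ (r : ℝ) (φ ψ : ℂ → ℂ), IsDnTwoData κ r φ ψ →
        ∀ z ∈ Metric.ball (0 : ℂ) r, z ∉ L.lattice →
          (1 - dnTwo ψ z) * (1 / 3 + L.weierstrassP z) = (κ : ℂ) ^ 2 / 2) ∧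
      -- the extension to an elliptic function, for which the identity holds globally
      ∃ g : ℂ → ℂ, IsEllipticFor L g ∧
        (∀ (r : ℝ) (φ ψ : ℂ → ℂ), IsDnTwoData κ r φ ψ →
          Set.EqOn g (dnTwo ψ) (Metric.ball 0 r)) ∧
        ∀ z : ℂ, z ∉ L.lattice → 1 / 3 + L.weierstrassP z ≠ 0 →
          (1 - g z) * (1 / 3 + L.weierstrassP z) = (κ : ℂ) ^ 2 / 2 := by
  have hκ : κ ^ 2 < 1 := pow_lt_one₀ hκ₀.le hκ₁ two_ne_zero
  refine ⟨exists_isDnTwoData κ, exists_hasDnTwoInvariants hκ₀.ne' hκ,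
    by rw [complementaryModulus_sq hκ.le]; ring, by rw [complementaryModulus_sq hκ.le]; ring,
    fun L hL ↦ ⟨fun r φ ψ h z hz hzL ↦ ?_, ellipticDnTwo κ L, ?_, fun r φ ψ h ↦ ?_,
      fun z hzL hne ↦ ?_⟩⟩
  · exact h.one_sub_dnTwo_mul hL hκ₀.ne' hκ.le hz hzL
  · exact isEllipticFor_ellipticDnTwo κ L
  · exact h.eqOn_ellipticDnTwo hL hκ₀.ne' hκ.le
  · exact one_sub_ellipticDnTwo_mul κ hzL hne
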